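/- Let $\mathbf T_n$ be the set of standard Young tableaux with $n$ boxes. For $T\in\mathbf T_n$ let $\mathrm{sh}(T)$ be its shape, let $r_T(a)$ be the number of the row containing $a$, and let $\pi_{1,k}(T)$ be the tableau formed by the boxes of $T$ containing $1,\dots,k$. Let $\mathfrak n$ be the space of strictly upper triangular complex $n\times n$ matrices. For a partition $\lambda$ of $n$ let $\mathcal O_\lambda$ be the set of nilpotent $n\times n$ matrices whose Jordan blocks have sizes $\lambda_1,\lambda_2,\dots$. For $T\in\mathbf T_n$ let $\nu_T$ be the set of $u\in\mathfrak n$ such that for every $1\le k\le n$ the upper left $k\times k$ block of $u$ lies in the nilpotent orbit of $k\times k$ matrices with Jordan block sizes $\mathrm{sh}(\pi_{1,k}(T))$, and let $\mathcal V_T=\overline{\nu_T}\cap\mathcal O_{\mathrm{sh}(T)}$ (the orbital variety of $T$; closures are Zariski closures). The geometric order on $\mathbf T_n$ is: $T\le_G S$ iff $\overline{\mathcal V}_T\supseteq\overline{\mathcal V}_S$. Partitions of $n$ are ordered by: $\lambda\le\mu$ iff $\mu_1+\dots+\mu_m\le\lambda_1+\dots+\lambda_m$ for all $m$ (equivalently,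 $\overline{\mathcal O}_\lambda\supseteq\mathcal O_\mu$). For either order, $b$ is in the cover of $a$ if $a\le b$, $a\neq b$, and every $c$ with $a\le c\le b$ equals $a$ or $b$; the cover is called the geometric cover for tableaux and the Gerstenhaber cover for partitions. **Lemma 7.3.** Let $T\in\mathbf T_n$ have shape $(\lambda_1,\dots,\lambda_j)$, put $\lambda_m=0$ for $m>j$, and let $r_T(n)=i$. Assume that $k\ge 1$ is minimal with $\lambda_{i+k}\le\lambda_i-2$. Then there is exactly one $S\in\mathbf T_n$ with $r_S(a)=r_T(a)$ for all $a<n$ and $r_S(n)=i+k$ (the tableau obtained from $T$ by moving the box containing $n$ from row $i$ to row $i+k$), and $S$ is in the geometric cover of $T$. If moreover $k>1$ and $\lambda_{i+k}<\lambda_i-2$, then $\mathrm{sh}(S)$ is not in the Gerstenhaber cover of $\mathrm{sh}(T)$; a jump of length $2$ occurs: there is a partition $\mu$ in the Gerstenhaber cover of $\mathrm{sh}(T)$ such that $\mathrm{sh}(S)$ is in the Gerstenhaber cover of $\mu$, and every partition $\nu$ with $\mathrm{sh}(T)\le\nu\le\mathrm{sh}(S)$ is one of $\mathrm{sh}(T)$,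 $\mu$, $\mathrm{sh}(S)$. -/

import Mathlib

/-- A standard Young tableau with `n` boxes: a Young diagram filled bijectively with
`1, …, n`, increasingly along rows (left to right) and down columns (top to bottom).
Rows and columns are indexed from `0`; for extensionality `entry` vanishes outside the diagram. -/
structure StdTableau (n : ℕ) where
  /-- The shape `sh(T)`. -/
  shape : YoungDiagram
  /-- `entry r s` is the content of the box in row `r` and column `s`. -/
  entry : ℕ → ℕ → ℕ
  bijOn : Set.BijOn (fun c : ℕ × ℕ => entry c.1 c.2) {c | c ∈ shape} (Set.Icc 1 n)
  row_strict : ∀ {r s₁ s₂ : ℕ}, s₁ < s₂ → (r, s₂) ∈ shape → entry r s₁ < entry r s₂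
  col_strict : ∀ {r₁ r₂ s : ℕ}, r₁ < r₂ → (r₂, s) ∈ shape → entry r₁ s < entry r₂ s
  zeros : ∀ {r s : ℕ}, (r, s) ∉ shape → entry r s = 0

namespace StdTableau

variable {n : ℕ}

/-- The number `a` lies in row `r` of `T`, i.e. `r_T(a) = r`. -/
def InRow (T : StdTableau n) (a r : ℕ) : Prop :=
  ∃ s, (r, s) ∈ T.shape ∧ T.entry r s = a

/-- The shape of `π_{1,k}(T)`: the boxes of `T` containing `1, …, k`. -/
def shapeLE (T : StdTableau n) (k : ℕ) : YoungDiagram where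
  cells := T.shape.cells.filter (fun c => T.entry c.1 c.2 ≤ k)
  isLowerSet := by
    rintro ⟨r, s⟩ ⟨r', s'⟩ hle hc
    simp only [Finset.coe_filter, Set.mem_ofPred_eq, YoungDiagram.mem_cells] at hc ⊢
    obtain ⟨hm, hk⟩ := hc
    obtain ⟨hr, hs⟩ : r' ≤ r ∧ s' ≤ s := hle
    have hm' : (r, s') ∈ T.shape := T.shape.up_left_mem le_rfl hs hm
    refine ⟨T.shape.up_left_mem hr hs hm, ?_⟩
    have h1 : T.entry r s' ≤ T.entry r s := by
      rcases hs.lt_or_eq with h | h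
      · exact (T.row_strict h hm).le
      · rw [h]
    have h2 : T.entry r' s' ≤ T.entry r s' := by
      rcases hr.lt_or_eq with h | h
      · exact (T.col_strict h hm').le
      · rw [h]
    omega

end StdTableau

/-- The square matrix `A` is nilpotent and its Jordan blocks have lengths the rows of `μ`:
there is a Jordan basis, indexed by the boxes of `μ`, in which `A` sends the vector of each box to
that of its left neighbour and kills the vectors of the boxes in the first column. -/
def HasJordanType {m : ℕ} (A : Matrix (Fin m) (Fin m) ℂ) (μ : YoungDiagram) : Prop :=
  ∃ b : Module.Basis {c : ℕ × ℕ // c ∈ μ} ℂ (Fin m → ℂ),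
    (∀ (r : ℕ) (h : (r, 0) ∈ μ), A.mulVec (b ⟨(r, 0), h⟩) = 0) ∧
    (∀ (r s : ℕ) (h : (r, s + 1) ∈ μ),
      A.mulVec (b ⟨(r, s + 1), h⟩) =
        b ⟨(r, s), μ.up_left_mem le_rfl (Nat.le_succ s) h⟩)

/-- The nilpotent orbit `𝒪_μ` of matrices of size `n` whose Jordan form is given by `μ`. -/
def nilpotentOrbit (n : ℕ) (μ : YoungDiagram) : Set (Matrix (Fin n) (Fin n) ℂ) :=
  {u | HasJordanType u μ}

/-- The strictly upper triangular matrices `𝔫`. -/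
def strictUpper (n : ℕ) : Set (Matrix (Fin n) (Fin n) ℂ) :=
  {u | ∀ a b : Fin n, b ≤ a → u a b = 0}

/-- The Zariski closure of a set of matrices: the common zeros of all polynomials in the matrix
entries that vanish on the set. -/
def zariskiClosure {n : ℕ} (X : Set (Matrix (Fin n) (Fin n) ℂ)) :
    Set (Matrix (Fin n) (Fin n) ℂ) :=
  {u | ∀ p : MvPolynomial (Fin n × Fin n) ℂ,
    (∀ v ∈ X, MvPolynomial.eval (fun q => v q.1 q.2) p = 0) →
      MvPolynomial.eval (fun q => u q.1 q.2) p = 0}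

namespace StdTableau

variable {n : ℕ}

/-- Spaltenstein's set `ν_T`: the strictly upper triangular `u` such that, for every `k ≤ n`, the
upper left `k × k` block of `u` has Jordan form given by the shape of `π_{1,k}(T)`. -/
def nu (T : StdTableau n) : Set (Matrix (Fin n) (Fin n) ℂ) :=
  {u | u ∈ strictUpper n ∧ ∀ (k : ℕ) (hk : k ≤ n),
    HasJordanType (u.submatrix (Fin.castLE hk) (Fin.castLE hk)) (T.shapeLE k)}

/-- The orbital variety `𝒱_T`, the closure of `ν_T` intersected with the orbit of shape `sh(T)`. -/
def orbitalVariety (T : StdTableau n) : Set (Matrix (Fin n) (Fin n) ℂ) :=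
  zariskiClosure T.nu ∩ nilpotentOrbit n T.shape

/-- The geometric order: `T ≤ S` when the closure of `𝒱_T` contains the closure of `𝒱_S`. -/
def GeomLE (T S : StdTableau n) : Prop :=
  zariskiClosure S.orbitalVariety ⊆ zariskiClosure T.orbitalVariety

end StdTableau

/-- The order on partitions of the same number that describes nilpotent orbit closures:
`D_lam ≤ D_mu` when the partial sums of `mu` are at most those of `lam`
(the reverse of the usual dominance order; diagrams of different sizes are incomparable). -/
def PartitionLE (lam mu : YoungDiagram) : Prop :=
  lam.card = mu.card ∧
    ∀ m : ℕ, ∑ r ∈ Finset.range m, mu.rowLen r ≤ ∑ r ∈ Finset.range m, lam.rowLen r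

/-- `b` is in the cover of `a` for the order `le`: `b > a` and any `c` with `a ≤ c ≤ b` is
`a` or `b`. -/
def InCover {α : Type*} (le : α → α → Prop) (a b : α) : Prop :=
  le a b ∧ a ≠ b ∧ ∀ c : α, le a c → le c b → c = a ∨ c = b

/-! Two facts about nilpotent matrices carry the geometric cover. A strictly upper triangular matrix
of size `m + 1` is its upper left block `u'` of size `m` together with a last column `v`. Its Jordan
type is that of `u'` plus one box, and the column of this box, counted from `0`, is the least `j`
with `v` in `range u' + ker (u' ^ j)`. If the box lies to the left of the end of a longer chain of
`u'`, adding `t` times the last vector of that chain to `v` moves the box to that chain for every `t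
≠ 0`. Letting `t` tend to `0` gives `T ≤ S` (`geomLE_of_move`, resting on
`exists_isJordanBasis_of_extend`).

Conversely, ranks of powers of upper left blocks can only drop on passing to a Zariski closure, and
they count the boxes in the columns from a given one on (`GeomLE.tailCount_le`). If `T ≤ R ≤ S`,
these counts agree for `T` and `S` in all blocks smaller than `n`, so `R` differs from `T` at most
in the place of `n`, and the column of `n` in `R` lies between those in `S` and `T`. By minimality
of `k`, without the box of `n` the rows `i, …, i + k - 1` of `T` have equal length, so among the
rows left only `i` and `i + k` can receive a box.

For partitions, the partial sums of an intermediate `nu` fall short of those of `sh(T)` by `0` or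
`1` at the indices `i + 1, …, i + k`, and by `0` elsewhere. Decreasing rows permit a shortfall
nowhere, only at `i + k`, or at all these indices (`PartitionLE.interval_of_move`). -/

namespace YoungDiagram

/-! ### Young diagrams through row lengths and column tails. -/

theorem ext_rowLen {μ ν : YoungDiagram} (h : ∀ r, μ.rowLen r = ν.rowLen r) : μ = ν := by
  ext ⟨r, s⟩
  rw [mem_cells, mem_cells, mem_iff_lt_rowLen, mem_iff_lt_rowLen, h]

/-- The Young diagram whose row lengths are given by `f`, cut off at the `N`-th row. -/
def ofRowFun (f : ℕ → ℕ) (hf : Antitone f) (N : ℕ) : YoungDiagram where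
  cells := (Finset.range N ×ˢ Finset.range (f 0)).filter (fun c => c.2 < f c.1)
  isLowerSet := by
    rintro ⟨r, s⟩ ⟨r', s'⟩ hle hc
    obtain ⟨hr, hs⟩ : r' ≤ r ∧ s' ≤ s := hle
    simp only [Finset.coe_filter, Finset.mem_product, Finset.mem_range, Set.mem_ofPred_eq] at hc ⊢
    have := hf hr
    omega

theorem rowLen_ofRowFun (f : ℕ → ℕ) (hf : Antitone f) (N : ℕ) (hN : f N = 0) (r : ℕ) :
    (ofRowFun f hf N).rowLen r = f r := by
  have key : ∀ s, s < (ofRowFun f hf N).rowLen r ↔ s < f r := by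
    intro s
    rw [← mem_iff_lt_rowLen, ← mem_cells]
    simp only [ofRowFun, Finset.mem_filter, Finset.mem_product, Finset.mem_range]
    refine ⟨fun h => h.2, fun h => ⟨⟨?_, h.trans_le (hf (Nat.zero_le r))⟩, h⟩⟩
    by_contra hr
    have := hf (not_lt.mp hr)
    omega
  exact le_antisymm (not_lt.mp fun h => lt_irrefl _ ((key _).mp h))
    (not_lt.mp fun h => lt_irrefl _ ((key _).mpr h))

theorem exists_rowLen_eq_zero (μ : YoungDiagram) : ∃ N, ∀ r, N ≤ r → μ.rowLen r = 0 := by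
  refine ⟨μ.colLen 0, fun r hr => ?_⟩
  by_contra h
  have : (r, 0) ∈ μ := mem_iff_lt_rowLen.mpr (Nat.pos_of_ne_zero h)
  rw [mem_iff_lt_colLen] at this
  omega

theorem card_eq_sum_rowLen (μ : YoungDiagram) (N : ℕ) (hN : ∀ r, N ≤ r → μ.rowLen r = 0) :
    μ.card = ∑ r ∈ Finset.range N, μ.rowLen r := by
  have h : ∀ c ∈ μ.cells, c.1 ∈ Finset.range N := by
    rintro ⟨r, s⟩ hc
    rw [mem_cells, mem_iff_lt_rowLen] at hc
    rw [Finset.mem_range]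
    by_contra hr
    have := hN r (not_lt.mp hr)
    omega
  rw [YoungDiagram.card, Finset.card_eq_sum_card_fiberwise h]
  exact Finset.sum_congr rfl fun r _ => (μ.rowLen_eq_card).symm

/-- The number of boxes in the columns from the `j`-th on. -/
def tailCount (μ : YoungDiagram) (j : ℕ) : ℕ :=
  (μ.cells.filter (fun c => j ≤ c.2)).card

theorem tailCount_eq_add_colLen (μ : YoungDiagram) (j : ℕ) :
    μ.tailCount j = μ.tailCount (j + 1) + μ.colLen j := by
  rw [colLen_eq_card, tailCount, tailCount, ← Finset.card_union_of_disjoint]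
  · congr 1
    ext c
    simp only [col, Finset.mem_filter, Finset.mem_union]
    constructor
    · rintro ⟨h, h'⟩
      rcases h'.lt_or_eq with h' | h'
      · exact .inl ⟨h, h'⟩
      · exact .inr ⟨h, h'.symm⟩
    · rintro (⟨h, h'⟩ | ⟨h, h'⟩)
      · exact ⟨h, by omega⟩
      · exact ⟨h, by omega⟩
  · rw [Finset.disjoint_left]
    intro c hc hc'
    simp only [col, Finset.mem_filter] at hc hc'
    omega

/-- Consecutive differences of tail counts are the column lengths. Since tail counts are ranks of
powers, this recovers a Jordan type from ranks. -/
theorem ext_tailCount {μ ν : YoungDiagram} (h : ∀ j, μ.tailCount j = ν.tailCount j) : μ = ν := by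
  ext ⟨r, s⟩
  rw [mem_cells, mem_cells, mem_iff_lt_colLen, mem_iff_lt_colLen]
  have h1 := μ.tailCount_eq_add_colLen s
  have h2 := ν.tailCount_eq_add_colLen s
  rw [h s, h (s + 1)] at h1
  omega

theorem tailCount_insert {μ ν : YoungDiagram} {c : ℕ × ℕ} (h : μ.cells = insert c ν.cells)
    (hc : c ∉ ν) (j : ℕ) : μ.tailCount j = ν.tailCount j + if j ≤ c.2 then 1 else 0 := by
  rw [tailCount, tailCount, h, Finset.filter_insert]
  split_ifs with hj
  · rw [Finset.card_insert_of_notMem]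
    simp [hc]
  · rfl

theorem rowLen_insert {μ ν : YoungDiagram} {c : ℕ × ℕ} (h : μ.cells = insert c ν.cells)
    (hc : c ∉ ν) (r : ℕ) : μ.rowLen r = ν.rowLen r + if r = c.1 then 1 else 0 := by
  rw [rowLen_eq_card, rowLen_eq_card, row, row, h, Finset.filter_insert]
  split_ifs with h1 h2 h2
  · rw [Finset.card_insert_of_notMem]
    simp [hc]
  · exact absurd h1.symm h2
  · exact absurd h2.symm h1
  · rfl

theorem snd_eq_rowLen_of_insert {μ ν : YoungDiagram} {c : ℕ × ℕ}
    (h : μ.cells = insert c ν.cells) (hc : c ∉ ν) : c.2 = ν.rowLen c.1 := by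
  have h1 : (c.1, c.2) ∈ μ := by rw [← mem_cells, h]; exact Finset.mem_insert_self _ _
  have h2 : ¬ (c.1, c.2) ∈ ν := hc
  have h3 := rowLen_insert h hc c.1
  rw [mem_iff_lt_rowLen] at h1 h2
  rw [if_pos rfl] at h3
  omega

end YoungDiagram

/-! ### The interval between the two shapes in the partition order. -/

/-- Moving a box from the end of row `i` to the end of row `i + k`, past rows `i + 1, …, i + k - 1`
that are one box shorter than row `i`, is a step of length two for `PartitionLE`
when `1 < k` and the box moves by more than two columns. -/
theorem PartitionLE.interval_of_move {lam sig : YoungDiagram} {i k : ℕ} (hk : 1 < k)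
    (hrow : ∀ j, 1 ≤ j → j < k → lam.rowLen (i + j) + 1 = lam.rowLen i)
    (hik : lam.rowLen (i + k) + 2 < lam.rowLen i)
    (hsig : ∀ r, sig.rowLen r + (if r = i then 1 else 0) =
      lam.rowLen r + if r = i + k then 1 else 0) :
    ¬ InCover PartitionLE lam sig ∧
      ∃ mu : YoungDiagram, InCover PartitionLE lam mu ∧ InCover PartitionLE mu sig ∧
        ∀ nu : YoungDiagram, PartitionLE lam nu → PartitionLE nu sig →
          nu = lam ∨ nu = mu ∨ nu = sig := by
  obtain ⟨N, hN⟩ := lam.exists_rowLen_eq_zero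
  have hki : i + k - 1 + 1 = i + k := by omega
  have hrow' := hrow (k - 1) (by omega) (by omega)
  rw [← Nat.add_sub_assoc hk.le] at hrow'
  have hanti := lam.rowLen_anti
  obtain ⟨mu, hmu⟩ : ∃ mu : YoungDiagram, ∀ r, mu.rowLen r + (if r = i + k - 1 then 1 else 0) =
      lam.rowLen r + if r = i + k then 1 else 0 := by
    -- The strict inequality `hik` is needed here: row `i + k - 1` shrinks to `lam.rowLen i - 2`,
    -- which must be at least `lam.rowLen (i + k) + 1`.
    have hf : Antitone fun r => lam.rowLen r + (if r = i + k then 1 else 0) -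
        (if r = i + k - 1 then 1 else 0) := by
      refine antitone_nat_of_succ_le fun r => ?_
      have h1 := hanti r (r + 1) (Nat.le_succ r)
      rcases eq_or_ne (r + 1) (i + k) with h | h
      · have : r = i + k - 1 := by omega
        subst this
        simp only [h]
        split_ifs <;> omega
      · rcases eq_or_ne r (i + k) with h' | h'
        · subst h'
          simp only [if_true]
          split_ifs <;> omega
        · rcases eq_or_ne (r + 1) (i + k - 1) with h2 | h2
          · simp only [h2] at h1 ⊢
            split_ifs <;> omega
          · split_ifs <;> omega
    refine ⟨YoungDiagram.ofRowFun _ hf (N + i + k + 1), fun r => ?_⟩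
    rw [YoungDiagram.rowLen_ofRowFun]
    · rcases eq_or_ne r (i + k - 1) with h | h
      · subst h
        split_ifs <;> omega
      · split_ifs <;> omega
    · have := hN (N + i + k + 1) (by omega)
      rw [this]
      split_ifs <;> omega
  let P : YoungDiagram → ℕ → ℕ := fun μ m => ∑ r ∈ Finset.range m, μ.rowLen r
  have P0 : ∀ μ, P μ 0 = 0 := fun μ => Finset.sum_range_zero _
  have Ps : ∀ μ m, P μ (m + 1) = P μ m + μ.rowLen m := fun μ m => Finset.sum_range_succ _ _
  have Psig : ∀ m, P sig m + (if i < m ∧ m ≤ i + k then 1 else 0) = P lam m := by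
    intro m
    induction m with
    | zero => simp [P0]
    | succ m ih =>
      have := hsig m
      rw [Ps, Ps]
      split_ifs at * <;> omega
  have Pmu : ∀ m, P mu m + (if m = i + k then 1 else 0) = P lam m := by
    intro m
    induction m with
    | zero => simp [P0]; omega
    | succ m ih =>
      have := hmu m
      rw [Ps, Ps]
      split_ifs at * <;> omega
  have hcard : ∀ μ ν : YoungDiagram, (∃ M, ∀ m, M ≤ m → P μ m = P ν m) → μ.card = ν.card := by
    rintro μ ν ⟨M, hM⟩
    obtain ⟨A, hA⟩ := μ.exists_rowLen_eq_zero
    obtain ⟨B, hB⟩ := ν.exists_rowLen_eq_zero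
    rw [μ.card_eq_sum_rowLen (M + A + B) fun r hr => hA r (by omega),
      ν.card_eq_sum_rowLen (M + A + B) fun r hr => hB r (by omega)]
    exact hM _ (by omega)
  have hlm : PartitionLE lam mu := by
    refine ⟨hcard _ _ ⟨i + k + 1, fun m hm => ?_⟩, fun m => ?_⟩
    · have := Pmu m
      split_ifs at this <;> omega
    · exact (Nat.le_add_right _ _).trans_eq (Pmu m)
  have hms : PartitionLE mu sig := by
    refine ⟨hcard _ _ ⟨i + k + 1, fun m hm => ?_⟩, fun m => ?_⟩
    · have := Pmu m
      have := Psig m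
      split_ifs at * <;> omega
    · change P sig m ≤ P mu m
      have := Pmu m
      have := Psig m
      split_ifs at * <;> omega
  have hlam_ne_mu : lam ≠ mu := by
    intro h
    have := Pmu (i + k)
    rw [← h, if_pos rfl] at this
    omega
  have hmu_ne_sig : mu ≠ sig := by
    intro h
    have h1 := Pmu (i + 1)
    have h2 := Psig (i + 1)
    rw [h, if_neg (by omega)] at h1
    rw [if_pos (by omega)] at h2
    omega
  have ext_P : ∀ μ ν : YoungDiagram, (∀ m, P μ m = P ν m) → μ = ν := by
    intro μ ν h
    refine YoungDiagram.ext_rowLen fun r => ?_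
    have h1 := h (r + 1)
    have h2 := h r
    rw [Ps, Ps] at h1
    omega
  have hint : ∀ nu : YoungDiagram, PartitionLE lam nu → PartitionLE nu sig →
      nu = lam ∨ nu = mu ∨ nu = sig := by
    rintro nu ⟨-, hln⟩ ⟨-, hns⟩
    replace hln : ∀ m, P nu m ≤ P lam m := hln
    replace hns : ∀ m, P sig m ≤ P nu m := hns
    have hanu := nu.rowLen_anti
    have hout : ∀ m, ¬ (i < m ∧ m ≤ i + k) → P nu m = P lam m := by
      intro m hm
      have := Psig m
      rw [if_neg hm] at this
      exact le_antisymm (hln m) (by have := hns m; omega)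
    have hin : ∀ m, P nu m = P lam m ∨ P nu m + 1 = P lam m := by
      intro m
      have := Psig m
      have := hns m
      have := hln m
      split_ifs at * <;> omega
    have hi0 := hout i (by omega)
    rcases hin (i + 1) with h1 | h1
    -- No shortfall can start before `i + k`: it would cut a row of `nu` to `lam.rowLen i - 2`. The
    -- next row would be no longer, so the shortfall would reach `2`.
    · have hz : ∀ j, j + 2 ≤ k → P nu (i + (j + 1)) = P lam (i + (j + 1)) := by
        intro j
        induction j with
        | zero => exact fun _ => h1
        | succ j ih =>
          intro hj
          have e1 := ih (by omega)
          refine (hin _).resolve_right fun h => ?_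
          have a1 := Ps nu (i + (j + 1))
          have a2 := Ps lam (i + (j + 1))
          have a3 := Ps nu (i + (j + 1) + 1)
          have a4 := Ps lam (i + (j + 1) + 1)
          have a5 := hanu (i + (j + 1)) (i + (j + 1) + 1) (by omega)
          have a6 := hrow (j + 1) (by omega) (by omega)
          have a7 := hrow (j + 1 + 1) (by omega) (by omega)
          have a8 := hin (i + (j + 1) + 1 + 1)
          simp only [← Nat.add_assoc] at *
          have := hln (i + j + 1 + 1 + 1)
          omega
      have hz' : ∀ m, m ≠ i + k → P nu m = P lam m := by
        intro m hm
        by_cases h : i < m ∧ m ≤ i + k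
        · have := hz (m - i - 1) (by omega)
          rwa [show i + (m - i - 1 + 1) = m by omega] at this
        · exact hout m h
      rcases hin (i + k) with h2 | h2
      · left
        refine ext_P _ _ fun m => ?_
        rcases eq_or_ne m (i + k) with h | h
        · rw [h, h2]
        · exact hz' m h
      · right; left
        refine ext_P _ _ fun m => ?_
        have := Pmu m
        rcases eq_or_ne m (i + k) with h | h
        · rw [h, if_pos rfl] at this
          rw [h]
          omega
        · rw [if_neg h] at this
          rw [hz' m h]
          omega
    · right; right
      -- Once row `i` of `nu` has length `lam.rowLen i - 1`, the rows below are no longer than that,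
      -- which is the length of the rows of `lam` strictly between `i` and `i + k`. So the shortfall
      -- is never made up before index `i + k`.
      have hz : ∀ j, j + 1 ≤ k → P nu (i + (j + 1)) + 1 = P lam (i + (j + 1)) := by
        intro j
        induction j with
        | zero => exact fun _ => h1
        | succ j ih =>
          intro hj
          have e1 := ih (by omega)
          refine (hin _).resolve_left fun h => ?_
          have a0 := Ps nu i
          have a0' := Ps lam i
          have a1 := Ps nu (i + (j + 1))
          have a2 := Ps lam (i + (j + 1))
          have a5 := hanu i (i + (j + 1)) (by omega)
          have a6 := hrow (j + 1) (by omega) (by omega)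
          simp only [← Nat.add_assoc] at *
          omega
      refine ext_P _ _ fun m => ?_
      have := Psig m
      by_cases h : i < m ∧ m ≤ i + k
      · have h2 := hz (m - i - 1) (by omega)
        rw [show i + (m - i - 1 + 1) = m by omega] at h2
        rw [if_pos h] at this
        omega
      · rw [if_neg h] at this
        rw [hout m h]
        omega
  have hanti' : ∀ μ ν : YoungDiagram, PartitionLE μ ν → PartitionLE ν μ → μ = ν :=
    fun μ ν h h' => ext_P _ _ fun m => le_antisymm (h'.2 m) (h.2 m)
  have htrans : ∀ μ ν ρ : YoungDiagram, PartitionLE μ ν → PartitionLE ν ρ → PartitionLE μ ρ :=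
    fun μ ν ρ h h' => ⟨h.1.trans h'.1, fun m => (h'.2 m).trans (h.2 m)⟩
  refine ⟨fun h => ?_, mu, ⟨hlm, hlam_ne_mu, fun c h h' => ?_⟩, ⟨hms, hmu_ne_sig, fun c h h' => ?_⟩,
    hint⟩
  · rcases h.2.2 mu hlm hms with h | h
    · exact hlam_ne_mu h.symm
    · exact hmu_ne_sig h
  · rcases hint c h (htrans _ _ _ h' hms) with h1 | h1 | h1
    · exact .inl h1
    · exact .inr h1
    · exact absurd (hanti' _ _ hms (h1 ▸ h')) hmu_ne_sig
  · rcases hint c (htrans _ _ _ hlm h) h' with h1 | h1 | h1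
    · exact absurd (hanti' _ _ hlm (h1 ▸ h)) hlam_ne_mu
    · exact .inl h1
    · exact .inr h1

/-! ### Jordan bases and extension by one vector. -/

section JordanBasis

variable {V W : Type*} [AddCommGroup V] [Module ℂ V] [AddCommGroup W] [Module ℂ W]

/-- The basis `b`, indexed by the boxes of `μ`, is a Jordan basis of the nilpotent endomorphism `f`:
`f` sends the vector of each box to that of its left neighbour, or to `0`. -/
def IsJordanBasis (f : Module.End ℂ V) (μ : YoungDiagram)
    (b : Module.Basis {c : ℕ × ℕ // c ∈ μ} ℂ V) : Prop :=
  (∀ (r : ℕ) (h : (r, 0) ∈ μ), f (b ⟨(r, 0), h⟩) = 0) ∧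
    ∀ (r s : ℕ) (h : (r, s + 1) ∈ μ),
      f (b ⟨(r, s + 1), h⟩) = b ⟨(r, s), μ.up_left_mem le_rfl (Nat.le_succ s) h⟩

theorem hasJordanType_iff {m : ℕ} {A : Matrix (Fin m) (Fin m) ℂ} {μ : YoungDiagram} :
    HasJordanType A μ ↔ ∃ b, IsJordanBasis (Matrix.toLin' A) μ b :=
  Iff.rfl

namespace IsJordanBasis

variable {f : Module.End ℂ V} {μ : YoungDiagram} {b : Module.Basis {c : ℕ × ℕ // c ∈ μ} ℂ V}

theorem pow_apply_add (hb : IsJordanBasis f μ b) (j : ℕ) (r s : ℕ) (h : (r, s + j) ∈ μ) :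
    (f ^ j) (b ⟨(r, s + j), h⟩) = b ⟨(r, s), μ.up_left_mem le_rfl (Nat.le_add_right s j) h⟩ := by
  induction j with
  | zero => rfl
  | succ j ih =>
    rw [pow_succ, Module.End.mul_apply]
    exact (congrArg _ (hb.2 r (s + j) h)).trans (ih _)

theorem pow_apply_of_lt (hb : IsJordanBasis f μ b) (j : ℕ) (r s : ℕ) (h : (r, s) ∈ μ)
    (hs : s < j) : (f ^ j) (b ⟨(r, s), h⟩) = 0 := by
  obtain ⟨d, rfl⟩ := Nat.exists_eq_add_of_lt hs
  have h1 := hb.pow_apply_add s r 0 (by simpa using h)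
  simp only [Nat.zero_add] at h1
  rw [show s + d + 1 = d + 1 + s by omega, pow_add, Module.End.mul_apply, h1, pow_succ,
    Module.End.mul_apply, hb.1, map_zero]

theorem repr_pow_apply (hb : IsJordanBasis f μ b) (j : ℕ) (r s : ℕ) (h : (r, s + j) ∈ μ) (y : V) :
    b.repr ((f ^ j) y) ⟨(r, s), μ.up_left_mem le_rfl (Nat.le_add_right s j) h⟩ =
      b.repr y ⟨(r, s + j), h⟩ := by
  have key : (b.coord ⟨(r, s), μ.up_left_mem le_rfl (Nat.le_add_right s j) h⟩).comp (f ^ j) =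
      b.coord ⟨(r, s + j), h⟩ := by
    refine b.ext ?_
    rintro ⟨⟨r', s'⟩, h'⟩
    rw [LinearMap.comp_apply, Module.Basis.coord_apply, Module.Basis.coord_apply,
      Module.Basis.repr_self]
    rcases lt_or_ge s' j with hs | hs
    · rw [hb.pow_apply_of_lt j r' s' h' hs, map_zero, Finsupp.zero_apply,
        Finsupp.single_eq_of_ne]
      simp only [ne_eq, Subtype.mk.injEq, Prod.mk.injEq, not_and]
      omega
    · obtain ⟨d, rfl⟩ := Nat.exists_eq_add_of_le' hs
      rw [hb.pow_apply_add j r' d h', Module.Basis.repr_self]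
      simp [Finsupp.single_apply]
  exact LinearMap.congr_fun key y

theorem mem_span_of_pow_apply_eq_zero (hb : IsJordanBasis f μ b) {j : ℕ} {y : V}
    (hy : (f ^ j) y = 0) : y ∈ Submodule.span ℂ (b '' {c | c.1.2 < j}) := by
  rw [Module.Basis.mem_span_image]
  rintro ⟨⟨r, s⟩, h⟩ hc
  by_contra hs
  obtain ⟨d, rfl⟩ := Nat.exists_eq_add_of_le' (not_lt.mp hs)
  have := hb.repr_pow_apply j r d h y
  rw [hy, map_zero, Finsupp.zero_apply] at this
  exact (Finsupp.mem_support_iff.mp hc) this.symm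

/-- `f ^ j` shifts boxes `j` columns to the left and kills those in the first `j` columns, so its
range is spanned by distinct basis vectors, one for each surviving box. -/
theorem finrank_range_pow (hb : IsJordanBasis f μ b) (j : ℕ) :
    Module.finrank ℂ (LinearMap.range (f ^ j)) = μ.tailCount j := by
  let g : {c : ℕ × ℕ // c ∈ μ.cells.filter (fun c => j ≤ c.2)} → {c : ℕ × ℕ // c ∈ μ} := fun c =>
    ⟨(c.1.1, c.1.2 - j), μ.up_left_mem le_rfl (Nat.sub_le _ _)
      ((YoungDiagram.mem_cells _).mp (Finset.mem_filter.mp c.2).1)⟩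
  have hg : Function.Injective g := by
    rintro ⟨⟨r, s⟩, h⟩ ⟨⟨r', s'⟩, h'⟩ he
    have h1 := (Finset.mem_filter.mp h).2
    have h2 := (Finset.mem_filter.mp h').2
    simp only [g, Subtype.mk.injEq, Prod.mk.injEq] at he h1 h2 ⊢
    omega
  have hr : LinearMap.range (f ^ j) = Submodule.span ℂ (Set.range (b ∘ g)) := by
    rw [LinearMap.range_eq_map, ← b.span_eq, Submodule.map_span]
    apply le_antisymm
    · rw [Submodule.span_le]
      rintro _ ⟨_, ⟨⟨⟨r, s⟩, h⟩, rfl⟩, rfl⟩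
      rcases lt_or_ge s j with hs | hs
      · rw [hb.pow_apply_of_lt j r s h hs]
        exact Submodule.zero_mem _
      · refine Submodule.subset_span ⟨⟨(r, s), Finset.mem_filter.mpr
          ⟨(YoungDiagram.mem_cells _).mpr h, hs⟩⟩, ?_⟩
        obtain ⟨d, rfl⟩ := Nat.exists_eq_add_of_le' hs
        rw [hb.pow_apply_add j r d h]
        simp [g]
    · rw [Submodule.span_le]
      rintro _ ⟨⟨⟨r, s⟩, h⟩, rfl⟩
      obtain ⟨h1, h2⟩ := Finset.mem_filter.mp h
      rw [YoungDiagram.mem_cells] at h1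
      obtain ⟨d, rfl⟩ := Nat.exists_eq_add_of_le' h2
      refine Submodule.subset_span ⟨_, ⟨⟨(r, d + j), h1⟩, rfl⟩, ?_⟩
      rw [hb.pow_apply_add j r d h1]
      simp [g]
  rw [hr, finrank_span_eq_card (b.linearIndependent.comp g hg), Fintype.card_coe,
    YoungDiagram.tailCount]

theorem finrank_eq_card (b : Module.Basis {c : ℕ × ℕ // c ∈ μ} ℂ V) :
    Module.finrank ℂ V = μ.card := by
  have : Fintype {c : ℕ × ℕ // c ∈ μ} := inferInstanceAs (Fintype {c // c ∈ μ.cells})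
  rw [Module.finrank_eq_card_basis b]
  exact (Fintype.card_congr (Equiv.refl {c // c ∈ μ.cells})).trans (Fintype.card_coe _)

end IsJordanBasis

variable {f' : Module.End ℂ V} {f : Module.End ℂ W} {ι : V →ₗ[ℂ] W} {e : W} {v : V}

theorem comp_pow_apply_of_intertwine (hι : ∀ y, f (ι y) = ι (f' y)) (j : ℕ) (y : V) :
    (f ^ j) (ι y) = ι ((f' ^ j) y) := by
  induction j with
  | zero => rfl
  | succ j ih => rw [pow_succ', pow_succ', Module.End.mul_apply, Module.End.mul_apply, ih, hι]

/-- If extending `f'` by a vector `e` that is sent to `v` does not increase the rank of the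
`(j + 1)`-st power, then `v` lies in `range f' + ker (f' ^ j)`. -/
theorem exists_pow_apply_sub_eq_zero [FiniteDimensional ℂ W]
    (hinj : Function.Injective ι) (hι : ∀ y, f (ι y) = ι (f' y)) (he : f e = ι v) {j : ℕ}
    (hrank : Module.finrank ℂ (LinearMap.range (f ^ (j + 1))) =
      Module.finrank ℂ (LinearMap.range (f' ^ (j + 1)))) :
    ∃ x, (f' ^ j) (v - f' x) = 0 := by
  have hle : (LinearMap.range (f' ^ (j + 1))).map ι ≤ LinearMap.range (f ^ (j + 1)) := by
    rintro _ ⟨_, ⟨y, rfl⟩, rfl⟩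
    exact ⟨ι y, comp_pow_apply_of_intertwine hι _ _⟩
  have heq := Submodule.eq_of_le_of_finrank_eq hle
    ((Submodule.equivMapOfInjective ι hinj _).finrank_eq.symm.trans hrank.symm)
  have hmem : ι ((f' ^ j) v) ∈ LinearMap.range (f ^ (j + 1)) := by
    refine ⟨e, ?_⟩
    rw [pow_succ, Module.End.mul_apply, he, comp_pow_apply_of_intertwine hι]
  rw [← heq] at hmem
  obtain ⟨_, ⟨x, rfl⟩, hx⟩ := hmem
  refine ⟨x, ?_⟩
  rw [map_sub, ← hinj hx, pow_succ, Module.End.mul_apply, sub_self]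

/-- Extending a nilpotent endomorphism with Jordan basis `b` by a vector `e` that is sent, modulo
the range and the kernel of a small power, to a nonzero multiple of the last vector of the `i`-th
Jordan chain makes this chain longer by one. -/
theorem exists_isJordanBasis_of_extend [FiniteDimensional ℂ W] {μ μ' : YoungDiagram}
    {b : Module.Basis {c : ℕ × ℕ // c ∈ μ'} ℂ V} (hb : IsJordanBasis f' μ' b) {i q : ℕ}
    (hμ : μ.cells = insert (i, q + 1) μ'.cells) (hc : (i, q + 1) ∉ μ') (hq : (i, q) ∈ μ')
    (hι : ∀ y, f (ι y) = ι (f' y)) (hspan : LinearMap.range ι ⊔ Submodule.span ℂ {e} = ⊤)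
    (hW : Module.finrank ℂ W = Module.finrank ℂ V + 1) {x v₀ : V} {t : ℂ} (ht : t ≠ 0)
    (hv₀ : (f' ^ q) v₀ = 0) (he : f e = ι (f' x + v₀ + t • b ⟨(i, q), hq⟩)) :
    ∃ b', IsJordanBasis f μ b' := by
  have hmem : ∀ c, c ∈ μ ↔ c = (i, q + 1) ∨ c ∈ μ' := fun c => by
    rw [← YoungDiagram.mem_cells, hμ, Finset.mem_insert, YoungDiagram.mem_cells]
  have hlt : ∀ s, (i, s) ∈ μ' → s ≤ q := fun s hs => by
    by_contra h
    exact hc (μ'.up_left_mem le_rfl (by omega) hs)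
  set v' : V := v₀ + t • b ⟨(i, q), hq⟩ with hv'
  -- Subtracting `ι x` from `e` removes the part `f' x` of its image, so `e - ι x` maps to `ι v'`.
  -- Row `i` becomes the chain of successive images of this vector; the other chains are kept.
  let g : {c : ℕ × ℕ // c ∈ μ} → W := fun c =>
    if h : c.1 ∈ μ' then
      if c.1.1 = i then ι ((f' ^ (q - c.1.2)) v') else ι (b ⟨c.1, h⟩)
    else e - ι x
  have hg_row : ∀ s (h : (i, s) ∈ μ) (_ : (i, s) ∈ μ'),
      g ⟨(i, s), h⟩ = ι ((f' ^ (q - s)) v') := fun s h h' => by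
    simp only [g]
    rw [dif_pos h', if_true]
  have hg_ne : ∀ r s (h : (r, s) ∈ μ) (h' : (r, s) ∈ μ'), r ≠ i →
      g ⟨(r, s), h⟩ = ι (b ⟨(r, s), h'⟩) := fun r s h h' hr => by
    simp only [g]
    rw [dif_pos h', if_neg hr]
  have hg_new : ∀ h : (i, q + 1) ∈ μ, g ⟨(i, q + 1), h⟩ = e - ι x := fun h => by
    simp only [g]
    rw [dif_neg hc]
  -- Triangularity by columns: `(f' ^ (q - s)) v'` is `t` times the old vector of box `(i, s)` plus
  -- an element of `ker (f' ^ s)`, which earlier columns span.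
  have hbmem : ∀ s r (h : (r, s) ∈ μ'), ι (b ⟨(r, s), h⟩) ∈ Submodule.span ℂ (Set.range g) := by
    intro s
    induction s using Nat.strong_induction_on with
    | _ s ih =>
      intro r h
      have hμr : (r, s) ∈ μ := (hmem _).mpr (.inr h)
      rcases eq_or_ne r i with rfl | hr
      · have hsq := hlt s h
        have h1 : ι ((f' ^ (q - s)) v') ∈ Submodule.span ℂ (Set.range g) :=
          Submodule.subset_span ⟨⟨_, hμr⟩, hg_row s hμr h⟩
        have h2 : ι ((f' ^ (q - s)) v₀) ∈ Submodule.span ℂ (Set.range g) := by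
          have h3 : (f' ^ s) ((f' ^ (q - s)) v₀) = 0 := by
            rw [← Module.End.mul_apply, ← pow_add, Nat.add_sub_cancel' hsq, hv₀]
          have h4 := Submodule.mem_map_of_mem (f := ι) (hb.mem_span_of_pow_apply_eq_zero h3)
          rw [Submodule.map_span] at h4
          refine Submodule.span_le.mpr ?_ h4
          rintro _ ⟨_, ⟨⟨⟨r', s'⟩, h'⟩, hs', rfl⟩, rfl⟩
          exact ih s' hs' r' h'
        have h5 : (f' ^ (q - s)) (b ⟨(r, q), hq⟩) = b ⟨(r, s), h⟩ := by
          have := hb.pow_apply_add (q - s) r s (by rwa [Nat.add_sub_cancel' hsq])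
          simpa only [Nat.add_sub_cancel' hsq] using this
        rw [hv', map_add, map_smul, h5, map_add, map_smul] at h1
        have h6 := Submodule.sub_mem _ h1 h2
        rw [add_sub_cancel_left] at h6
        exact (Submodule.smul_mem_iff _ ht).mp h6
      · exact Submodule.subset_span ⟨⟨_, hμr⟩, hg_ne r s hμr h hr⟩
  have hιmem : ∀ y, ι y ∈ Submodule.span ℂ (Set.range g) := by
    intro y
    have h1 : y ∈ Submodule.span ℂ (Set.range b) := by rw [b.span_eq]; trivial
    have h4 := Submodule.mem_map_of_mem (f := ι) h1
    rw [Submodule.map_span] at h4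
    refine Submodule.span_le.mpr ?_ h4
    rintro _ ⟨_, ⟨⟨⟨r', s'⟩, h'⟩, rfl⟩, rfl⟩
    exact hbmem s' r' h'
  have hnew : (i, q + 1) ∈ μ := (hmem _).mpr (.inl rfl)
  have htop : ⊤ ≤ Submodule.span ℂ (Set.range g) := by
    rw [← hspan, sup_le_iff]
    constructor
    · rintro _ ⟨y, rfl⟩
      exact hιmem y
    · rw [Submodule.span_le, Set.singleton_subset_iff]
      have h0 : e - ι x ∈ Submodule.span ℂ (Set.range g) :=
        Submodule.subset_span ⟨⟨_, hnew⟩, hg_new hnew⟩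
      have h1 := Submodule.add_mem _ h0 (hιmem x)
      rwa [sub_add_cancel] at h1
  have : Fintype {c : ℕ × ℕ // c ∈ μ} := inferInstanceAs (Fintype {c // c ∈ μ.cells})
  have hcard : Fintype.card {c : ℕ × ℕ // c ∈ μ} = Module.finrank ℂ W := by
    have h1 : Fintype.card {c : ℕ × ℕ // c ∈ μ} = μ.cells.card :=
      (Fintype.card_congr (Equiv.refl {c // c ∈ μ.cells})).trans (Fintype.card_coe _)
    rw [h1, hW, IsJordanBasis.finrank_eq_card b, hμ, Finset.card_insert_of_notMem]
    rwa [YoungDiagram.mem_cells]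
  refine ⟨basisOfTopLeSpanOfCardEqFinrank g htop hcard, ?_, ?_⟩
  · intro r h
    rw [coe_basisOfTopLeSpanOfCardEqFinrank]
    have h' : (r, 0) ∈ μ' := ((hmem _).mp h).resolve_left (by simp)
    rcases eq_or_ne r i with rfl | hr
    · rw [hg_row 0 h h', hι, Nat.sub_zero, hv', map_add, map_smul, hv₀, zero_add]
      have h5 := hb.pow_apply_add q r 0 (by simpa using hq)
      simp only [Nat.zero_add] at h5
      rw [h5, map_smul, hb.1, smul_zero, map_zero]
    · rw [hg_ne r 0 h h' hr, hι, hb.1, map_zero]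
  · intro r s h
    rw [coe_basisOfTopLeSpanOfCardEqFinrank]
    by_cases h' : (r, s + 1) ∈ μ'
    · have h'' : (r, s) ∈ μ' := μ'.up_left_mem le_rfl (Nat.le_succ s) h'
      rcases eq_or_ne r i with rfl | hr
      · have := hlt _ h'
        rw [hg_row _ h h', hg_row _ _ h'', hι, ← Module.End.mul_apply, ← pow_succ',
          show q - (s + 1) + 1 = q - s by omega]
      · rw [hg_ne _ _ h h' hr, hg_ne _ _ _ h'' hr, hι, hb.2]
    · have h1 := ((hmem _).mp h).resolve_right h'
      simp only [Prod.mk.injEq, Nat.add_right_cancel_iff] at h1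
      obtain ⟨rfl, rfl⟩ := h1
      rw [hg_new, hg_row _ _ hq, map_sub, he, hι, Nat.sub_self, pow_zero, Module.End.one_apply,
        ← map_sub, hv']
      congr 1
      abel

end JordanBasis

/-! ### Tableaux as growing chains of shapes. -/

namespace StdTableau

variable {n : ℕ}

theorem mem_shapeLE {T : StdTableau n} {k r s : ℕ} :
    (r, s) ∈ T.shapeLE k ↔ (r, s) ∈ T.shape ∧ T.entry r s ≤ k := by
  rw [← YoungDiagram.mem_cells, shapeLE, Finset.mem_filter, YoungDiagram.mem_cells]

theorem entry_mem_Icc (T : StdTableau n) {r s : ℕ} (h : (r, s) ∈ T.shape) :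
    1 ≤ T.entry r s ∧ T.entry r s ≤ n :=
  T.bijOn.mapsTo h

theorem eq_of_entry_eq (T : StdTableau n) {c d : ℕ × ℕ} (hc : c ∈ T.shape) (hd : d ∈ T.shape)
    (h : T.entry c.1 c.2 = T.entry d.1 d.2) : c = d :=
  T.bijOn.injOn hc hd h

theorem shapeLE_of_le (T : StdTableau n) {k : ℕ} (hk : n ≤ k) : T.shapeLE k = T.shape := by
  ext ⟨r, s⟩
  rw [YoungDiagram.mem_cells, YoungDiagram.mem_cells, mem_shapeLE, and_iff_left_iff_imp]
  exact fun h => (T.entry_mem_Icc h).2.trans hk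

theorem shapeLE_zero (T : StdTableau n) : T.shapeLE 0 = ⊥ := by
  ext ⟨r, s⟩
  rw [YoungDiagram.mem_cells, YoungDiagram.mem_cells, mem_shapeLE]
  refine ⟨fun h => ?_, fun h => absurd h (YoungDiagram.notMem_bot _)⟩
  have := (T.entry_mem_Icc h.1).1
  omega

theorem ext_shapeLE {T S : StdTableau n} (h : ∀ k ≤ n, T.shapeLE k = S.shapeLE k) : T = S := by
  have hshape : T.shape = S.shape := by
    rw [← T.shapeLE_of_le le_rfl, ← S.shapeLE_of_le le_rfl, h n le_rfl]
  have hentry : T.entry = S.entry := by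
    ext r s
    by_cases hm : (r, s) ∈ T.shape
    · have hm' : (r, s) ∈ S.shape := hshape ▸ hm
      apply le_antisymm
      · have := h _ (S.entry_mem_Icc hm').2 ▸ mem_shapeLE.mpr ⟨hm', le_rfl⟩
        exact (mem_shapeLE.mp this).2
      · have := h _ (T.entry_mem_Icc hm).2 ▸ mem_shapeLE.mpr ⟨hm, le_rfl⟩
        exact (mem_shapeLE.mp this).2
    · rw [T.zeros hm, S.zeros (hshape ▸ hm)]
  cases T
  cases S
  simp only at hshape hentry
  subst hshape hentry
  rfl

theorem inRow_succ_iff {T : StdTableau n} {k r : ℕ} :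
    T.InRow (k + 1) r ↔ ∃ s, (r, s) ∈ T.shapeLE (k + 1) ∧ (r, s) ∉ T.shapeLE k := by
  refine exists_congr fun s => ?_
  rw [mem_shapeLE, mem_shapeLE]
  constructor
  · rintro ⟨h1, h2⟩
    exact ⟨⟨h1, h2.le⟩, fun h => by omega⟩
  · rintro ⟨⟨h1, h2⟩, h3⟩
    refine ⟨h1, ?_⟩
    by_contra h
    exact h3 ⟨h1, by omega⟩

theorem not_inRow_zero (T : StdTableau n) (r : ℕ) : ¬ T.InRow 0 r := by
  rintro ⟨s, h, h0⟩
  have := (T.entry_mem_Icc h).1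
  omega

theorem shapeLE_succ_of_inRow {T : StdTableau n} {k r : ℕ} (h : T.InRow (k + 1) r) :
    (T.shapeLE (k + 1)).cells = insert (r, (T.shapeLE k).rowLen r) (T.shapeLE k).cells ∧
      (r, (T.shapeLE k).rowLen r) ∉ T.shapeLE k := by
  obtain ⟨s, hs, he⟩ := h
  have h1 : (T.shapeLE (k + 1)).cells = insert (r, s) (T.shapeLE k).cells := by
    ext ⟨r', s'⟩
    rw [Finset.mem_insert, YoungDiagram.mem_cells, YoungDiagram.mem_cells, mem_shapeLE, mem_shapeLE]
    constructor
    · rintro ⟨h1, h2⟩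
      rcases h2.lt_or_eq with h2 | h2
      · exact .inr ⟨h1, by omega⟩
      · exact .inl (T.eq_of_entry_eq h1 hs (h2.trans he.symm))
    · rintro (h | ⟨h1, h2⟩)
      · simp only [Prod.mk.injEq] at h
        rw [h.1, h.2]
        exact ⟨hs, he.le⟩
      · exact ⟨h1, by omega⟩
  have h2 : (r, s) ∉ T.shapeLE k := by
    rw [mem_shapeLE]
    rintro ⟨-, h⟩
    omega
  have h3 : s = (T.shapeLE k).rowLen r := YoungDiagram.snd_eq_rowLen_of_insert h1 h2
  exact h3 ▸ ⟨h1, h2⟩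

theorem exists_inRow (T : StdTableau n) {a : ℕ} (h1 : 1 ≤ a) (h2 : a ≤ n) : ∃ r, T.InRow a r := by
  obtain ⟨⟨r, s⟩, h, he⟩ := T.bijOn.surjOn ⟨h1, h2⟩
  exact ⟨r, s, h, he⟩

theorem shapeLE_succ_eq {T S : StdTableau n} {k r : ℕ} (h : T.shapeLE k = S.shapeLE k)
    (hT : T.InRow (k + 1) r) (hS : S.InRow (k + 1) r) : T.shapeLE (k + 1) = S.shapeLE (k + 1) := by
  apply YoungDiagram.ext
  rw [(shapeLE_succ_of_inRow hT).1, (shapeLE_succ_of_inRow hS).1, h]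

/-- The column of a new box is forced, being the end of its row, so rows of entries and chains of
shapes carry the same information. -/
theorem forall_shapeLE_eq_iff {T S : StdTableau n} {m : ℕ} (hm : m ≤ n) :
    (∀ k ≤ m, T.shapeLE k = S.shapeLE k) ↔ ∀ a ≤ m, ∀ r, T.InRow a r ↔ S.InRow a r := by
  constructor
  · rintro h (_ | a) ha r
    · exact iff_of_false (T.not_inRow_zero r) (S.not_inRow_zero r)
    · rw [inRow_succ_iff, inRow_succ_iff, h a (by omega), h (a + 1) ha]
  · intro h k
    induction k with
    | zero => rw [shapeLE_zero, shapeLE_zero]; exact fun _ => rfl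
    | succ k ih =>
      intro hk
      obtain ⟨r, hr⟩ := T.exists_inRow (Nat.le_add_left 1 k) (hk.trans hm)
      exact shapeLE_succ_eq (ih (by omega)) hr ((h _ hk r).mp hr)

/-- The tableau obtained from `T` by moving the box with the largest entry to the end of
row `p`. -/
theorem exists_move {m : ℕ} (T : StdTableau (m + 1)) (p : ℕ)
    (hp : p = 0 ∨ (T.shapeLE m).rowLen p < (T.shapeLE m).rowLen (p - 1)) :
    ∃ S : StdTableau (m + 1), (∀ k ≤ m, S.shapeLE k = T.shapeLE k) ∧ S.InRow (m + 1) p := by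
  classical
  set s := (T.shapeLE m).rowLen p with hs
  have hnew : (p, s) ∉ T.shapeLE m := by
    rw [YoungDiagram.mem_iff_lt_rowLen]
    exact lt_irrefl _
  obtain ⟨D, hD⟩ : ∃ D : YoungDiagram, ∀ c, c ∈ D ↔ c = (p, s) ∨ c ∈ T.shapeLE m := by
    refine ⟨{ cells := insert (p, s) (T.shapeLE m).cells
              isLowerSet := ?_ }, fun c => ?_⟩
    · rintro ⟨r, c⟩ ⟨r', c'⟩ hle hc
      obtain ⟨hr, hc'⟩ : r' ≤ r ∧ c' ≤ c := hle
      simp only [Finset.coe_insert, Set.mem_insert_iff, Finset.mem_coe,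
        YoungDiagram.mem_cells, Prod.mk.injEq] at hc ⊢
      rcases hc with ⟨rfl, rfl⟩ | hc
      -- By `hp` row `p - 1`, hence every row above `p`, is longer than `s`, so it already contains
      -- the required box.
      · rcases hr.lt_or_eq with h | rfl
        · right
          rw [YoungDiagram.mem_iff_lt_rowLen]
          have := (T.shapeLE m).rowLen_anti r' (r - 1) (by omega)
          omega
        · rcases hc'.lt_or_eq with h | rfl
          · right
            rw [YoungDiagram.mem_iff_lt_rowLen]
            omega
          · exact .inl ⟨rfl, rfl⟩
      · exact .inr ((T.shapeLE m).up_left_mem hr hc' hc)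
    · rw [← YoungDiagram.mem_cells, Finset.mem_insert, YoungDiagram.mem_cells]
  let E : ℕ → ℕ → ℕ := fun r c =>
    if (r, c) = (p, s) then m + 1 else if (r, c) ∈ T.shapeLE m then T.entry r c else 0
  have hE_new : E p s = m + 1 := if_pos rfl
  have hE_old : ∀ r c, (r, c) ∈ T.shapeLE m → E r c = T.entry r c := fun r c h => by
    have hne : (r, c) ≠ (p, s) := fun h' => hnew (h' ▸ h)
    exact (if_neg hne).trans (if_pos h)
  have hE_le : ∀ r c, (r, c) ∈ T.shapeLE m → E r c < m + 1 := fun r c h => by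
    rw [hE_old r c h]
    exact Nat.lt_succ_of_le (mem_shapeLE.mp h).2
  refine ⟨⟨D, E, ⟨?_, ?_, ?_⟩, ?_, ?_, ?_⟩, ?_, ?_⟩
  · rintro ⟨r, c⟩ hc
    rcases (hD _).mp hc with h | h
    · obtain ⟨rfl, rfl⟩ := Prod.mk.inj h
      exact ⟨by simp [hE_new], by simp [hE_new]⟩
    · refine ⟨?_, (hE_le r c h).le⟩
      change 1 ≤ E r c
      rw [hE_old r c h]
      exact (T.entry_mem_Icc (mem_shapeLE.mp h).1).1
  · rintro ⟨r, c⟩ hc ⟨r', c'⟩ hc' heq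
    change E r c = E r' c' at heq
    rcases (hD _).mp hc with h | h <;> rcases (hD _).mp hc' with h' | h'
    · rw [h, h']
    · obtain ⟨rfl, rfl⟩ := Prod.mk.inj h
      have := hE_le _ _ h'
      omega
    · obtain ⟨rfl, rfl⟩ := Prod.mk.inj h'
      have := hE_le _ _ h
      omega
    · rw [hE_old _ _ h, hE_old _ _ h'] at heq
      exact T.eq_of_entry_eq (mem_shapeLE.mp h).1 (mem_shapeLE.mp h').1 heq
  · rintro a ⟨h1, h2⟩
    rcases h2.lt_or_eq with h2 | rfl
    · obtain ⟨⟨r, c⟩, hc, he⟩ := T.bijOn.surjOn (show a ∈ Set.Icc 1 (m + 1) from ⟨h1, h2.le⟩)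
      change T.entry r c = a at he
      have hm : (r, c) ∈ T.shapeLE m := mem_shapeLE.mpr ⟨hc, by omega⟩
      exact ⟨(r, c), (hD _).mpr (.inr hm), (hE_old r c hm).trans he⟩
    · exact ⟨(p, s), (hD _).mpr (.inl rfl), hE_new⟩
  · intro r c₁ c₂ hlt hc
    rcases (hD _).mp hc with h | h
    · obtain ⟨rfl, rfl⟩ := Prod.mk.inj h
      rw [hE_new]
      refine hE_le _ _ ?_
      rwa [YoungDiagram.mem_iff_lt_rowLen]
    · rw [hE_old _ _ h, hE_old _ _ ((T.shapeLE m).up_left_mem le_rfl hlt.le h)]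
      exact T.row_strict hlt (mem_shapeLE.mp h).1
  · intro r₁ r₂ c hlt hc
    rcases (hD _).mp hc with h | h
    · obtain ⟨rfl, rfl⟩ := Prod.mk.inj h
      rw [hE_new]
      refine hE_le _ _ ?_
      rw [YoungDiagram.mem_iff_lt_rowLen]
      have := (T.shapeLE m).rowLen_anti r₁ (r₂ - 1) (by omega)
      omega
    · rw [hE_old _ _ h, hE_old _ _ ((T.shapeLE m).up_left_mem hlt.le le_rfl h)]
      exact T.col_strict hlt (mem_shapeLE.mp h).1
  · intro r c hc
    rw [hD, not_or] at hc
    exact (if_neg hc.1).trans (if_neg hc.2)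
  · intro k hk
    ext ⟨r, c⟩
    rw [YoungDiagram.mem_cells, YoungDiagram.mem_cells]
    refine mem_shapeLE.trans (Iff.trans ?_ mem_shapeLE.symm)
    refine (and_congr_left' (hD _)).trans ?_
    change _ ∧ E r c ≤ k ↔ _
    constructor
    · rintro ⟨h | h, h2⟩
      · obtain ⟨rfl, rfl⟩ := Prod.mk.inj h
        omega
      · rw [hE_old _ _ h] at h2
        exact ⟨(mem_shapeLE.mp h).1, h2⟩
    · rintro ⟨h1, h2⟩
      have h : (r, c) ∈ T.shapeLE m := mem_shapeLE.mpr ⟨h1, h2.trans hk⟩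
      exact ⟨.inr h, (hE_old _ _ h).trans_le h2⟩
  · exact ⟨s, (hD _).mpr (.inl rfl), hE_new⟩

end StdTableau

/-! ### Zariski closures and semicontinuity of rank. -/

section Zariski

variable {n : ℕ} {X Y : Set (Matrix (Fin n) (Fin n) ℂ)}

theorem subset_zariskiClosure (X : Set (Matrix (Fin n) (Fin n) ℂ)) : X ⊆ zariskiClosure X :=
  fun u hu _ hp => hp u hu

theorem zariskiClosure_subset_of_subset (h : X ⊆ zariskiClosure Y) :
    zariskiClosure X ⊆ zariskiClosure Y :=
  fun _ hu p hp => hu p fun _ hv => h hv p hp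

/-- If all points `u + t • w` with `t ≠ 0` lie in `X`, then `u` lies in the closure of `X`. -/
theorem mem_zariskiClosure_of_line {u w : Matrix (Fin n) (Fin n) ℂ}
    (h : ∀ t : ℂ, t ≠ 0 → u + t • w ∈ X) : u ∈ zariskiClosure X := by
  intro p hp
  have hc : Continuous fun t : ℂ =>
      MvPolynomial.eval (fun q : Fin n × Fin n => (u + t • w) q.1 q.2) p := by
    refine (MvPolynomial.continuous_eval p).comp (continuous_pi fun q => ?_)
    simp only [Matrix.add_apply, Matrix.smul_apply, smul_eq_mul]
    fun_prop
  -- The usual topology suffices: a polynomial in `t` vanishing on the dense set `t ≠ 0` vanishes at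
  -- `0`.
  have h0 := Continuous.ext_on (dense_compl_singleton (0 : ℂ)) hc
    (continuous_const (y := (0 : ℂ))) fun t ht => hp _ (h t ht)
  simpa using congrFun h0 0

/-- The columns of `Q` are preimages of `r` independent vectors in the range of `M`, and `P` is a
left inverse of `M * Q`. This turns a lower bound on rank into the nonvanishing of one polynomial.
-/
theorem Matrix.exists_det_ne_zero_of_le_rank {k r : ℕ} (M : Matrix (Fin k) (Fin k) ℂ)
    (h : r ≤ M.rank) : ∃ (P : Matrix (Fin r) (Fin k) ℂ) (Q : Matrix (Fin k) (Fin r) ℂ),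
      (P * M * Q).det ≠ 0 := by
  obtain ⟨w, hw⟩ := exists_linearIndependent_of_le_finrank (R := ℂ)
    (M := LinearMap.range M.mulVecLin) (n := r) h
  choose q hq using fun l => (w l).2
  let φ : (Fin r → ℂ) →ₗ[ℂ] (Fin k → ℂ) := M.toLin' ∘ₗ Matrix.toLin' (Matrix.of fun a l => q l a)
  have hφ : ∀ l, φ (Pi.single l 1) = w l := fun l => by
    rw [← hq l]
    simp only [φ, LinearMap.comp_apply, Matrix.toLin'_apply, Matrix.mulVecLin_apply]
    congr 1
    ext a
    simp
  have hker : LinearMap.ker φ = ⊥ := by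
    have h1 : LinearIndependent ℂ (φ ∘ Pi.basisFun ℂ (Fin r)) := by
      have h2 : φ ∘ Pi.basisFun ℂ (Fin r) = fun l => ((w l : Fin k → ℂ)) := by
        ext1 l
        simp [hφ]
      rw [h2]
      exact hw.map' (Submodule.subtype _) (Submodule.ker_subtype _)
    rw [LinearMap.ker_eq_bot']
    intro y hy
    have h3 := Fintype.linearIndependent_iff.mp h1 y (by
      rw [← hy]
      conv_rhs => rw [← (Pi.basisFun ℂ (Fin r)).sum_repr y]
      simp [map_sum])
    exact funext h3
  obtain ⟨ψ, hψ⟩ := φ.exists_leftInverse_of_injective hker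
  refine ⟨LinearMap.toMatrix' ψ, Matrix.of fun a l => q l a, ?_⟩
  have h4 : LinearMap.toMatrix' ψ * M * Matrix.of (fun a l => q l a) = 1 := by
    apply Matrix.toLin'.injective
    rw [Matrix.toLin'_mul, Matrix.toLin'_mul, Matrix.toLin'_toMatrix', Matrix.toLin'_one,
      LinearMap.comp_assoc, ← hψ]
  rw [h4, Matrix.det_one]
  exact one_ne_zero

/-- With `P` and `Q` chosen at `u`, the determinant of `P * (v.submatrix g g) ^ j * Q`, of size `r +
1`, is a polynomial in the entries of `v`. It vanishes on `X` by the rank bound but not at `u`. -/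
theorem rank_pow_submatrix_le_of_mem_zariskiClosure {k : ℕ} (g : Fin k → Fin n) (j r : ℕ)
    (hX : ∀ v ∈ X, ((v.submatrix g g) ^ j).rank ≤ r) {u : Matrix (Fin n) (Fin n) ℂ}
    (hu : u ∈ zariskiClosure X) : ((u.submatrix g g) ^ j).rank ≤ r := by
  by_contra! hlt
  obtain ⟨P, Q, hPQ⟩ := Matrix.exists_det_ne_zero_of_le_rank _ (Nat.succ_le_of_lt hlt)
  let Z : Matrix (Fin k) (Fin k) (MvPolynomial (Fin n × Fin n) ℂ) :=
    Matrix.of fun a b => MvPolynomial.X (g a, g b)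
  let P' : Matrix (Fin (r + 1)) (Fin k) (MvPolynomial (Fin n × Fin n) ℂ) :=
    P.map MvPolynomial.C
  let Q' : Matrix (Fin k) (Fin (r + 1)) (MvPolynomial (Fin n × Fin n) ℂ) :=
    Q.map MvPolynomial.C
  let p : MvPolynomial (Fin n × Fin n) ℂ :=
    (P' * Z ^ j * Q').det
  have hp : ∀ v : Matrix (Fin n) (Fin n) ℂ, MvPolynomial.eval (fun q => v q.1 q.2) p =
      (P * (v.submatrix g g) ^ j * Q).det := by
    intro v
    rw [RingHom.map_det, RingHom.mapMatrix_apply, Matrix.map_mul, Matrix.map_mul,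
      ← RingHom.mapMatrix_apply _ (Z ^ j), map_pow]
    congr 3
    · ext a b
      simp [P']
    · congr 1
      ext a b
      simp [Z]
    · ext a b
      simp [Q']
  refine hPQ ?_
  rw [← hp]
  refine hu p fun v hv => ?_
  rw [hp]
  by_contra hne
  have h1 := Matrix.rank_of_isUnit _ ((Matrix.isUnit_iff_isUnit_det _).mpr (Ne.isUnit hne))
  rw [Fintype.card_fin] at h1
  have h2 := (Matrix.rank_mul_le_left (P * (v.submatrix g g) ^ j) Q).trans
    (Matrix.rank_mul_le_right P ((v.submatrix g g) ^ j))
  have := hX v hv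
  omega

theorem HasJordanType.rank_pow {k : ℕ} {A : Matrix (Fin k) (Fin k) ℂ} {μ : YoungDiagram}
    (h : HasJordanType A μ) (j : ℕ) : (A ^ j).rank = μ.tailCount j := by
  obtain ⟨b, hb⟩ := hasJordanType_iff.mp h
  rw [← hb.finrank_range_pow j, ← Matrix.toLin'_pow]
  rfl

end Zariski

/-! ### Spaltenstein's sets and rank conditions for the geometric order. -/

namespace StdTableau

variable {n : ℕ}

/-- The matrix sending the basis vector of each entry of `T` to that of its left neighbour lies
in `ν_T`. -/
theorem nu_nonempty (T : StdTableau n) : T.nu.Nonempty := by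
  classical
  let u : Matrix (Fin n) (Fin n) ℂ := Matrix.of fun a b =>
    if ∃ r s, (r, s + 1) ∈ T.shape ∧ T.entry r s = a + 1 ∧ T.entry r (s + 1) = b + 1 then 1 else 0
  refine ⟨u, fun a b hab => if_neg ?_, fun k hk => ?_⟩
  · rintro ⟨r, s, h, ha, hb⟩
    have := T.row_strict (Nat.lt_add_one s) h
    have : (b : ℕ) ≤ a := hab
    omega
  · have hIcc : ∀ c : {c : ℕ × ℕ // c ∈ T.shapeLE k},
        1 ≤ T.entry c.1.1 c.1.2 ∧ T.entry c.1.1 c.1.2 ≤ k := fun c => by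
      obtain ⟨h1, h2⟩ := mem_shapeLE.mp c.2
      exact ⟨(T.entry_mem_Icc h1).1, h2⟩
    -- Entries start at `1` and matrix indices at `0`, hence the shift.
    let φ₀ : {c : ℕ × ℕ // c ∈ T.shapeLE k} → Fin k := fun c =>
      ⟨T.entry c.1.1 c.1.2 - 1, by have := hIcc c; omega⟩
    have hφ₀ : ∀ c, (φ₀ c : ℕ) + 1 = T.entry c.1.1 c.1.2 := fun c => by
      have := hIcc c
      change T.entry c.1.1 c.1.2 - 1 + 1 = _
      omega
    have hbij : Function.Bijective φ₀ := by
      constructor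
      · intro c d hcd
        refine Subtype.ext (T.eq_of_entry_eq (mem_shapeLE.mp c.2).1 (mem_shapeLE.mp d.2).1 ?_)
        rw [← hφ₀, ← hφ₀, hcd]
      · intro a
        obtain ⟨⟨r, s⟩, hc, he⟩ := T.bijOn.surjOn
          (show (a : ℕ) + 1 ∈ Set.Icc 1 n from ⟨by omega, by omega⟩)
        have he' : T.entry r s = a + 1 := he
        refine ⟨⟨(r, s), mem_shapeLE.mpr ⟨hc, by omega⟩⟩, Fin.ext ?_⟩
        change T.entry r s - 1 = a
        omega
    let φ := Equiv.ofBijective φ₀ hbij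
    have hb : ∀ c, ((Pi.basisFun ℂ (Fin k)).reindex φ.symm) c = Pi.single (φ₀ c) 1 := fun c => by
      rw [Module.Basis.reindex_apply, Equiv.symm_symm, Pi.basisFun_apply]
      rfl
    refine ⟨(Pi.basisFun ℂ (Fin k)).reindex φ.symm, fun r h => ?_, fun r s h => ?_⟩
    · rw [hb, Matrix.mulVec_single_one]
      ext a
      refine if_neg ?_
      rintro ⟨r', s', h', -, h2⟩
      have h3 := hφ₀ ⟨(r, 0), h⟩
      have h4 : T.entry r' (s' + 1) = T.entry r 0 := by
        rw [h2, ← h3]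
        rfl
      have := T.eq_of_entry_eq h' (mem_shapeLE.mp h).1 h4
      simp at this
    · rw [hb, hb, Matrix.mulVec_single_one]
      ext a
      have h' := (mem_shapeLE.mp h).1
      have hs := (T.shapeLE k).up_left_mem le_rfl (Nat.le_succ s) h
      have h3 := hφ₀ ⟨(r, s + 1), h⟩
      have h5 := hφ₀ ⟨(r, s), hs⟩
      rw [Pi.single_apply]
      refine if_congr ?_ rfl rfl
      constructor
      · rintro ⟨r', s', h1, h2, h4⟩
        have h6 : T.entry r' (s' + 1) = T.entry r (s + 1) := by
          rw [h4, ← h3]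
          rfl
        have h7 := T.eq_of_entry_eq h1 h' h6
        simp only [Prod.mk.injEq, Nat.add_right_cancel_iff] at h7
        obtain ⟨rfl, rfl⟩ := h7
        refine Fin.ext (Nat.add_right_cancel (m := 1) ?_)
        rw [h5]
        exact h2.symm
      · rintro rfl
        exact ⟨r, s, h', h5.symm, h3.symm⟩

theorem nu_subset_orbitalVariety (T : StdTableau n) : T.nu ⊆ T.orbitalVariety := fun _ hu =>
  ⟨subset_zariskiClosure _ hu, T.shapeLE_of_le le_rfl ▸ hu.2 n le_rfl⟩

/-- The orbital variety lies between `T.nu` and its closure, so both have the same closure. -/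
theorem geomLE_iff {T S : StdTableau n} : T.GeomLE S ↔ S.nu ⊆ zariskiClosure T.nu := by
  constructor
  · intro h
    refine ((subset_zariskiClosure _).trans ?_).trans
      (zariskiClosure_subset_of_subset (X := T.orbitalVariety) Set.inter_subset_left)
    exact (zariskiClosure_subset_of_subset
      (S.nu_subset_orbitalVariety.trans (subset_zariskiClosure _))).trans h
  · intro h
    refine zariskiClosure_subset_of_subset (Set.inter_subset_left.trans ?_)
    refine (zariskiClosure_subset_of_subset h).trans (zariskiClosure_subset_of_subset ?_)
    exact T.nu_subset_orbitalVariety.trans (subset_zariskiClosure _)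

/-- A point of `S.nu` realises the tail counts of `S` as ranks and lies in the closure of `T.nu`,
where the ranks of `T` are upper bounds. -/
theorem GeomLE.tailCount_le {T S : StdTableau n} (h : T.GeomLE S) {k : ℕ} (hk : k ≤ n) (j : ℕ) :
    (S.shapeLE k).tailCount j ≤ (T.shapeLE k).tailCount j := by
  obtain ⟨u, hu⟩ := S.nu_nonempty
  rw [← (hu.2 k hk).rank_pow j]
  exact rank_pow_submatrix_le_of_mem_zariskiClosure _ j _
    (fun v hv => ((hv.2 k hk).rank_pow j).le) (geomLE_iff.mp h hu)

theorem ext_of_shapeLE_of_inRow {m r : ℕ} {T S : StdTableau (m + 1)}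
    (h : ∀ k ≤ m, T.shapeLE k = S.shapeLE k) (hT : T.InRow (m + 1) r) (hS : S.InRow (m + 1) r) :
    T = S := by
  refine ext_shapeLE fun k hk => ?_
  rcases hk.lt_or_eq with hk | rfl
  · exact h k (by omega)
  · exact shapeLE_succ_eq (h m le_rfl) hT hS

end StdTableau

/-! ### A strictly upper triangular matrix as an extension of its upper left block. -/

section Bordering

variable {m : ℕ}

/-- Appending a zero to a vector. -/
def snocZero (m : ℕ) : (Fin m → ℂ) →ₗ[ℂ] (Fin (m + 1) → ℂ) where
  toFun y := Fin.snoc (α := fun _ => ℂ) y 0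
  map_add' x y := by
    ext a
    refine Fin.lastCases ?_ (fun a => ?_) a <;> simp
  map_smul' c y := by
    ext a
    refine Fin.lastCases ?_ (fun a => ?_) a <;> simp

@[simp]
theorem snocZero_castSucc (y : Fin m → ℂ) (a : Fin m) : snocZero m y a.castSucc = y a :=
  Fin.snoc_castSucc (α := fun _ => ℂ) _ _ _

@[simp]
theorem snocZero_last (y : Fin m → ℂ) : snocZero m y (Fin.last m) = 0 :=
  Fin.snoc_last (α := fun _ => ℂ) _ _

theorem snocZero_injective : Function.Injective (snocZero m) := fun x y h => by
  ext a
  rw [← snocZero_castSucc x, h, snocZero_castSucc]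

theorem range_snocZero_sup_span_single :
    LinearMap.range (snocZero m) ⊔ Submodule.span ℂ {Pi.single (Fin.last m) 1} = ⊤ := by
  rw [eq_top_iff]
  intro y _
  refine Submodule.mem_sup.mpr ⟨snocZero m fun a => y a.castSucc, ⟨_, rfl⟩,
    y (Fin.last m) • Pi.single (Fin.last m) 1,
    Submodule.smul_mem _ _ (Submodule.mem_span_singleton_self _), ?_⟩
  ext a
  refine Fin.lastCases ?_ (fun a => ?_) a
  · simp
  · simp [(Fin.castSucc_lt_last a).ne]

variable {M : Matrix (Fin (m + 1)) (Fin (m + 1)) ℂ}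

theorem toLin'_snocZero (hM : M ∈ strictUpper (m + 1)) (y : Fin m → ℂ) :
    Matrix.toLin' M (snocZero m y) =
      snocZero m (Matrix.toLin' (M.submatrix Fin.castSucc Fin.castSucc) y) := by
  ext a
  refine Fin.lastCases ?_ (fun a => ?_) a
  · rw [snocZero_last, Matrix.toLin'_apply, Matrix.mulVec, dotProduct]
    exact Finset.sum_eq_zero fun b _ => by rw [hM _ _ (Fin.le_last b), zero_mul]
  · rw [snocZero_castSucc, Matrix.toLin'_apply, Matrix.toLin'_apply, Matrix.mulVec, dotProduct,
      Fin.sum_univ_castSucc]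
    simp [Matrix.mulVec, dotProduct]

theorem toLin'_single_last (hM : M ∈ strictUpper (m + 1)) :
    Matrix.toLin' M (Pi.single (Fin.last m) 1) =
      snocZero m fun a => M a.castSucc (Fin.last m) := by
  rw [Matrix.toLin'_apply, Matrix.mulVec_single_one]
  ext a
  refine Fin.lastCases ?_ (fun a => ?_) a
  · rw [snocZero_last]
    exact hM _ _ le_rfl
  · rw [snocZero_castSucc]
    rfl

end Bordering

/-! ### Degeneration by moving the largest entry. -/

namespace StdTableau

/-- Moving the largest entry to a row in which it lies further to the left
yields a larger tableau in the geometric order. -/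
theorem geomLE_of_move {m p q : ℕ} {T S : StdTableau (m + 1)}
    (h : ∀ k ≤ m, T.shapeLE k = S.shapeLE k) (hT : T.InRow (m + 1) p) (hS : S.InRow (m + 1) q)
    (hlt : (T.shapeLE m).rowLen q < (T.shapeLE m).rowLen p) : T.GeomLE S := by
  rw [geomLE_iff]
  intro u hu
  obtain ⟨hT1, hT2⟩ := shapeLE_succ_of_inRow hT
  obtain ⟨hS1, hS2⟩ := shapeLE_succ_of_inRow hS
  rw [← h m le_rfl] at hS1 hS2
  obtain ⟨d, hd⟩ : ∃ d, (T.shapeLE m).rowLen p = d + 1 := ⟨(T.shapeLE m).rowLen p - 1, by omega⟩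
  rw [hd] at hT1 hT2 hlt
  have hpd : (p, d) ∈ T.shapeLE m := by
    rw [YoungDiagram.mem_iff_lt_rowLen]
    omega
  obtain ⟨b, hb⟩ := hasJordanType_iff.mp ((h m le_rfl).symm ▸ hu.2 m (Nat.le_succ m))
  replace hb : IsJordanBasis (Matrix.toLin' (u.submatrix Fin.castSucc Fin.castSucc))
      (T.shapeLE m) b := hb
  -- In `S` the new box has column index `rowLen q`, so it does not contribute to the rank of the
  -- power `rowLen q + 1`.
  obtain ⟨x, hx⟩ := exists_pow_apply_sub_eq_zero (j := (T.shapeLE m).rowLen q)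
    snocZero_injective (toLin'_snocZero hu.1) (toLin'_single_last hu.1) (by
      have h1 := hb.finrank_range_pow ((T.shapeLE m).rowLen q + 1)
      obtain ⟨b', hb'⟩ := hasJordanType_iff.mp (hu.2 (m + 1) le_rfl)
      have h2 := hb'.finrank_range_pow ((T.shapeLE m).rowLen q + 1)
      rw [YoungDiagram.tailCount_insert hS1 hS2, if_neg (by simp), add_zero] at h2
      exact h2.trans h1.symm)
  have hv₀ : ((Matrix.toLin' (u.submatrix Fin.castSucc Fin.castSucc)) ^ d)
      ((fun a => u a.castSucc (Fin.last m)) -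
        Matrix.toLin' (u.submatrix Fin.castSucc Fin.castSucc) x) = 0 := by
    obtain ⟨e, rfl⟩ := Nat.exists_eq_add_of_le' (Nat.lt_succ_iff.mp hlt)
    rw [pow_add, Module.End.mul_apply, hx, map_zero]
  -- The perturbation changes only the last column, by the last vector of chain `p`; smaller blocks
  -- do not see it, and the full matrix acquires the shape of `T` for `t ≠ 0`.
  let w : Matrix (Fin (m + 1)) (Fin (m + 1)) ℂ := Matrix.of fun a c =>
    if c = Fin.last m then snocZero m (b ⟨(p, d), hpd⟩) a else 0
  refine mem_zariskiClosure_of_line (w := w) fun t ht => ?_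
  have hcast : ∀ a c : Fin (m + 1), c ≠ Fin.last m → (u + t • w) a c = u a c := fun a c hc => by
    simp [w, hc]
  have hup : u + t • w ∈ strictUpper (m + 1) := by
    intro a c hca
    by_cases hc : c = Fin.last m
    · subst hc
      have ha : a = Fin.last m := le_antisymm (Fin.le_last a) hca
      subst ha
      simp [w, hu.1 _ _ le_rfl]
    · rw [hcast a c hc, hu.1 a c hca]
  refine ⟨hup, fun k hk => ?_⟩
  rcases hk.lt_or_eq with hkm | rfl
  · rw [h k (by omega)]
    convert hu.2 k hk using 1
    ext a c
    refine hcast _ _ fun hc => ?_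
    have := congrArg Fin.val hc
    have := c.2
    simp at *
    omega
  · have hsub : (u + t • w).submatrix Fin.castSucc Fin.castSucc =
        u.submatrix Fin.castSucc Fin.castSucc := by
      ext a c
      exact hcast _ _ (Fin.castSucc_lt_last c).ne
    have hι := toLin'_snocZero hup
    rw [hsub] at hι
    refine hasJordanType_iff.mpr (exists_isJordanBasis_of_extend (x := x) hb hT1 hT2 hpd hι
      range_snocZero_sup_span_single (by simp) ht hv₀ ((toLin'_single_last hup).trans ?_))
    congr 1
    ext a
    rw [add_sub_cancel]
    simp [w]

end StdTableau

/-! ### The cover statement. -/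

theorem lemma7p3 (n : ℕ) (T : StdTableau n) (i k : ℕ)
    (hi : T.InRow n i)
    (hk : 1 ≤ k)
    (hik : T.shape.rowLen (i + k) + 2 ≤ T.shape.rowLen i)
    (hmin : ∀ m : ℕ, 1 ≤ m → m < k → ¬ (T.shape.rowLen (i + m) + 2 ≤ T.shape.rowLen i)) :
    (∃! S : StdTableau n,
      (∀ a : ℕ, a < n → ∀ r : ℕ, S.InRow a r ↔ T.InRow a r) ∧ S.InRow n (i + k)) ∧
    (∀ S : StdTableau n,
      (∀ a : ℕ, a < n → ∀ r : ℕ, S.InRow a r ↔ T.InRow a r) → S.InRow n (i + k) →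
        InCover StdTableau.GeomLE T S ∧
        (1 < k → T.shape.rowLen (i + k) + 2 < T.shape.rowLen i →
          ¬ InCover PartitionLE T.shape S.shape ∧
          ∃ mu : YoungDiagram,
            InCover PartitionLE T.shape mu ∧ InCover PartitionLE mu S.shape ∧
            ∀ nu : YoungDiagram, PartitionLE T.shape nu → PartitionLE nu S.shape →
              nu = T.shape ∨ nu = mu ∨ nu = S.shape)) := by
  obtain _ | m := n
  · exact absurd hi (T.not_inRow_zero i)
  have hiff : ∀ S : StdTableau (m + 1), (∀ a : ℕ, a < m + 1 → ∀ r : ℕ, S.InRow a r ↔ T.InRow a r) ↔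
      ∀ k ≤ m, S.shapeLE k = T.shapeLE k := fun S => by
    rw [StdTableau.forall_shapeLE_eq_iff (Nat.le_succ m)]
    exact forall_congr' fun a => by rw [Nat.lt_succ_iff]
  simp only [hiff]
  set T' := T.shapeLE m with hT'
  have hrow : ∀ (R : StdTableau (m + 1)) (p : ℕ), R.shapeLE m = T' → R.InRow (m + 1) p →
      ∀ r, R.shape.rowLen r = T'.rowLen r + if r = p then 1 else 0 := fun R p hR hp r => by
    obtain ⟨h1, h2⟩ := StdTableau.shapeLE_succ_of_inRow hp
    have := YoungDiagram.rowLen_insert h1 h2 r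
    rwa [R.shapeLE_of_le le_rfl, hR] at this
  -- A box can be added at the end of row `p` only if all rows above are strictly longer.
  have hcorner : ∀ (R : StdTableau (m + 1)) (p : ℕ), R.shapeLE m = T' → R.InRow (m + 1) p →
      ∀ r < p, T'.rowLen p < T'.rowLen r := fun R p hR hp r hr => by
    have h1 := R.shape.rowLen_anti r p hr.le
    rw [hrow R p hR hp, hrow R p hR hp, if_pos rfl, if_neg hr.ne] at h1
    omega
  have hTrow := hrow T i rfl hi
  have hflat : ∀ j < k, T'.rowLen (i + j) = T'.rowLen i := by
    rintro (_ | j) hj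
    · rfl
    · have h1 := hmin (j + 1) (by omega) hj
      have h2 := T'.rowLen_anti i (i + (j + 1)) (by omega)
      rw [hTrow, hTrow, if_pos rfl, if_neg (by omega)] at h1
      omega
  have hlast : T'.rowLen (i + k) < T'.rowLen i := by
    rw [hTrow, hTrow, if_pos rfl, if_neg (by omega)] at hik
    omega
  refine ⟨?_, fun S hS hSn => ⟨⟨?_, ?_, fun R hTR hRS => ?_⟩, fun hk1 hik' => ?_⟩⟩
  · obtain ⟨S, hS, hSn⟩ := T.exists_move (i + k) (.inr (by
      have := hflat (k - 1) (by omega)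
      rw [← Nat.add_sub_assoc hk] at this
      exact hlast.trans_eq this.symm))
    exact ⟨S, ⟨hS, hSn⟩, fun R hR => StdTableau.ext_of_shapeLE_of_inRow
      (fun k hk => (hR.1 k hk).trans (hS k hk).symm) hR.2 hSn⟩
  · exact StdTableau.geomLE_of_move (fun k hk => (hS k hk).symm) hi hSn hlast
  · rintro rfl
    have h1 := hrow T (i + k) rfl hSn i
    rw [hTrow, if_pos rfl, if_neg (by omega)] at h1
    omega
  -- `T` and `S` have the same tail counts below the top level, which squeezes those of `R`.
  · have hR : ∀ l ≤ m, R.shapeLE l = T.shapeLE l := fun l hl =>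
      YoungDiagram.ext_tailCount fun j => le_antisymm (hTR.tailCount_le (by omega) j)
        (hS l hl ▸ hRS.tailCount_le (by omega) j)
    obtain ⟨p, hp⟩ := R.exists_inRow (Nat.le_add_left 1 m) le_rfl
    have htail : ∀ (Q : StdTableau (m + 1)) (r : ℕ), Q.shapeLE m = T' → Q.InRow (m + 1) r →
        ∀ j, (Q.shapeLE (m + 1)).tailCount j = T'.tailCount j + if j ≤ T'.rowLen r then 1 else 0 :=
      fun Q r hQ hr j => by
        obtain ⟨h1, h2⟩ := StdTableau.shapeLE_succ_of_inRow hr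
        rw [hQ] at h1 h2
        exact YoungDiagram.tailCount_insert h1 h2 j
    -- Evaluating the tail count at the column of the new box of `R` detects whether the new box of
    -- `T` lies at least as far right.
    have h1 : T'.rowLen p ≤ T'.rowLen i := by
      have := hTR.tailCount_le le_rfl (T'.rowLen p)
      rw [htail R p (hR m le_rfl) hp, htail T i rfl hi, if_pos le_rfl] at this
      by_contra h
      rw [if_neg h] at this
      omega
    have h2 : T'.rowLen (i + k) ≤ T'.rowLen p := by
      have := hRS.tailCount_le le_rfl (T'.rowLen (i + k))
      rw [htail R p (hR m le_rfl) hp, htail S _ (hS m le_rfl) hSn, if_pos le_rfl] at this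
      by_contra h
      rw [if_neg h] at this
      omega
    have hpi : i ≤ p := by
      by_contra h
      have := hcorner T i rfl hi p (by omega)
      omega
    have hpk : p ≤ i + k := by
      by_contra h
      have := hcorner R p (hR m le_rfl) hp (i + k) (by omega)
      omega
    obtain ⟨j, rfl⟩ := Nat.exists_eq_add_of_le hpi
    rcases Nat.eq_zero_or_pos j with rfl | hj
    · exact .inl (StdTableau.ext_of_shapeLE_of_inRow hR hp hi)
    · rcases (Nat.le_of_add_le_add_left hpk).lt_or_eq with hjk | rfl
      -- Row `i + j` of `T'` is as long as row `i` above it, so no box fits at its end.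
      · have h3 := hcorner R _ (hR m le_rfl) hp i (by omega)
        rw [hflat j hjk] at h3
        omega
      · exact .inr (StdTableau.ext_of_shapeLE_of_inRow
          (fun l hl => (hR l hl).trans (hS l hl).symm) hp hSn)
  · refine PartitionLE.interval_of_move hk1 (fun j hj hjk => ?_) hik' fun r => ?_
    · rw [hTrow, hTrow, if_pos rfl, if_neg (by omega), hflat j hjk]
    · rw [hTrow, hrow S _ (hS m le_rfl) hSn]
      omega
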